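/- **Theorem 5.1 (label stability).** Let $(M,g)$ be a finite-dimensional smooth Riemannian manifold (Hausdorff, without boundary), let $\mathbf F=(F_1,\dots,F_k):M\to\mathbb R^k$ be smooth, let $c$ be a regular value of $\mathbf F$, and let $S=\mathbf F^{-1}(c)$, a smooth embedded submanifold of $M$. Let $X_S$ be a smooth vector field on $S$ and $x_e\in S$ an equilibrium point of it, i.e. $X_S(x_e)=0$. Let $X$ be a smooth vector field on $M$ that extends $X_S$, i.e. $X|_S=X_S$, and let $G:M\to\mathbb R$ be a $C^2$ function that extends a function $G_S:S\to\mathbb R$. Gradients are taken with respect to $g$, and $\mathrm{Hess}\,f(x)(v,w)=\langle\nabla_v\,\mathrm{grad} f,w\rangle$ for $v,w\in T_xM$, where $\nabla$ is the Levi-Civita connection of $g$. For functions $f_1,\dots,f_r,h_1,\dots,h_s$ on $M$ let $\Sigma^{(f_1,\dots,f_r)}_{(h_1,\dots,h_s)}$ be the $r\times s$ matrix whose entry in row $a$ and column $b$ is $\langle\mathrm{grad}\,h_b,\mathrm{grad}\,f_a\rangle$, and put $$\sigma_i(x)=\frac{\det\Sigma^{(F_1,\dots,F_k)}_{(F_1,\dots,F_{i-1},G,F_{i+1},\dots,F_k)}(x)}{\det\Sigma^{(F_1,\dots,F_k)}_{(F_1,\dots,F_k)}(x)},\qquad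 i=1,\dots,k .$$ Suppose that (i) $\mathbf L_XG\le 0$ on $M$; (ii) $\mathrm{grad}\,G(x_e)=\sum_{i=1}^k\sigma_i(x_e)\,\mathrm{grad}\,F_i(x_e)$; (iii) the restriction of $\mathrm{Hess}\,G(x_e)-\sum_{i=1}^k\sigma_i(x_e)\,\mathrm{Hess}\,F_i(x_e)$ to $T_{x_e}S\times T_{x_e}S$ is positive definite. Then $x_e$ is a stable equilibrium of $X_S$: for each neighbourhood $U$ of $x_e$ in $S$ there is a neighbourhood $V$ of $x_e$ in $S$ such that from each point of $V$ there starts a solution of $\dot x=X_S(x)$ that exists for all $t\ge 0$, and all solutions that start in $V$, on whatever interval $[0,T)$, stay in $U$. -/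

import Mathlib

open scoped Manifold ContDiff Topology
open Set

noncomputable section

namespace ConstrainedStability

section Riemannian

variable {E : Type*} [NormedAddCommGroup E] [NormedSpace ℝ E] [FiniteDimensional ℝ E]
  {M : Type*} [TopologicalSpace M] [ChartedSpace E M] [IsManifold 𝓘(ℝ, E) ∞ M]

/-- The type of smooth Riemannian metrics on a (boundaryless, finite-dimensional) smooth manifold
`M` modelled on `E`. -/
abbrev SmoothMetric (E : Type*) [NormedAddCommGroup E] [NormedSpace ℝ E]
    (M : Type*) [TopologicalSpace M] [ChartedSpace E M] [IsManifold 𝓘(ℝ, E) ∞ M] :=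
  Bundle.ContMDiffRiemannianMetric 𝓘(ℝ, E) ∞ E (fun x : M ↦ TangentSpace 𝓘(ℝ, E) x)

/-- The scalar product of a Riemannian metric on one tangent space, as a bilinear form. -/
def metricForm (g : SmoothMetric E M) (x : M) :
    LinearMap.BilinForm ℝ (TangentSpace 𝓘(ℝ, E) x) :=
  LinearMap.mk₂ ℝ (fun v w ↦ g.inner x v w)
    (by intros; simp) (by intros; simp) (by intros; simp) (by intros; simp)

instance (x : M) : FiniteDimensional ℝ (TangentSpace 𝓘(ℝ, E) x) :=
  inferInstanceAs (FiniteDimensional ℝ E)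

theorem metricForm_nondegenerate (g : SmoothMetric E M) (x : M) :
    (metricForm g x).Nondegenerate := by
  refine ⟨fun v hv ↦ ?_, fun v hv ↦ ?_⟩ <;>
  · by_contra h
    exact (g.pos x v h).ne' (hv v)

/-- The musical isomorphism `♯`: `sharp g x ℓ` is the tangent vector with
`⟨sharp g x ℓ, w⟩ = ℓ w` for all `w`. -/
def sharp (g : SmoothMetric E M) (x : M) (l : TangentSpace 𝓘(ℝ, E) x →L[ℝ] ℝ) :
    TangentSpace 𝓘(ℝ, E) x :=
  ((metricForm g x).toDual (metricForm_nondegenerate g x)).symm l.toLinearMap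

theorem inner_sharp (g : SmoothMetric E M) (x : M) (l : TangentSpace 𝓘(ℝ, E) x →L[ℝ] ℝ)
    (w : TangentSpace 𝓘(ℝ, E) x) : g.inner x (sharp g x l) w = l w :=
  LinearMap.BilinForm.apply_toDual_symm_apply (hB := metricForm_nondegenerate g x)
    l.toLinearMap w

/-- The Riemannian gradient: `⟨grad f (x), w⟩ = df_x(w)` for all `w ∈ T_x M`. -/
def grad (g : SmoothMetric E M) (f : M → ℝ) (x : M) : TangentSpace 𝓘(ℝ, E) x :=
  sharp g x (mvfderiv 𝓘(ℝ, E) f x)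

/-- The differential at `y` of the preferred chart `φ` at `x`; it sends a tangent vector at `y` to
its coordinate vector. -/
def chartDeriv (x y : M) : TangentSpace 𝓘(ℝ, E) y →L[ℝ] E :=
  mfderiv 𝓘(ℝ, E) 𝓘(ℝ, E) (extChartAt 𝓘(ℝ, E) x) y

/-- The differential at `p` of the inverse `φ⁻¹` of the preferred chart at `x`; it sends a coordinate
vector to the corresponding tangent vector at `φ⁻¹ p`. -/
def chartSymmDeriv (x : M) (p : E) :
    E →L[ℝ] TangentSpace 𝓘(ℝ, E) ((extChartAt 𝓘(ℝ, E) x).symm p) :=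
  mfderiv 𝓘(ℝ, E) 𝓘(ℝ, E) (extChartAt 𝓘(ℝ, E) x).symm p

/-- The metric read in the preferred chart `φ` at `x` (pull-back of `g` by `φ⁻¹`): at the point `p`
of the model space it is `(a, b) ↦ g (dφ⁻¹_p a, dφ⁻¹_p b)`. -/
def coordMetric (g : SmoothMetric E M) (x : M) (p : E) : E →L[ℝ] E →L[ℝ] ℝ :=
  (ContinuousLinearMap.precomp ℝ (chartSymmDeriv x p)) ∘L
    (g.inner ((extChartAt 𝓘(ℝ, E) x).symm p)) ∘L (chartSymmDeriv x p)

theorem coordMetric_apply (g : SmoothMetric E M) (x : M) (p a b : E) :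
    coordMetric g x p a b = g.inner ((extChartAt 𝓘(ℝ, E) x).symm p)
      (chartSymmDeriv x p a) (chartSymmDeriv x p b) := rfl

/-- The Christoffel symbols of the first kind at `x`, in the preferred chart at `x`, as a linear
form in the last argument:
`c ↦ ½ (∂_a g(b, c) + ∂_b g(a, c) - ∂_c g(a, b))`. -/
def christoffelFirst (g : SmoothMetric E M) (x : M) (a b : E) : E →L[ℝ] ℝ :=
  let D : E →L[ℝ] E →L[ℝ] E →L[ℝ] ℝ := fderiv ℝ (coordMetric g x) (extChartAt 𝓘(ℝ, E) x x)
  (1 / 2 : ℝ) • (D a b + D b a - (D.flip a).flip b)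

theorem christoffelFirst_apply (g : SmoothMetric E M) (x : M) (a b c : E) :
    christoffelFirst g x a b c = 1 / 2 *
      (fderiv ℝ (coordMetric g x) (extChartAt 𝓘(ℝ, E) x x) a b c
        + fderiv ℝ (coordMetric g x) (extChartAt 𝓘(ℝ, E) x x) b a c
        - fderiv ℝ (coordMetric g x) (extChartAt 𝓘(ℝ, E) x x) c a b) := by
  simp [christoffelFirst]

/-- The coordinate expression, in the preferred chart at `x`, of a vector field `Y`. -/
def coordField (Y : (x : M) → TangentSpace 𝓘(ℝ, E) x) (x : M) (p : E) : E :=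
  chartDeriv x ((extChartAt 𝓘(ℝ, E) x).symm p) (Y ((extChartAt 𝓘(ℝ, E) x).symm p))

/-- The Levi-Civita covariant derivative `∇_v Y` at `x` of a vector field `Y` differentiable at `x`,
in the direction `v ∈ T_x M`. It is the classical formula
`(∇_v Y)^m = ∂_v Y^m + Γ^m_{ij} v^i Y^j` in the preferred chart at `x`, with the index `m` lowered:
the linear form `w ↦ g(∂_v Y, w) + Γ(v, Y, w)`, with `Γ` the Christoffel symbols of the first kind,
to which `♯` is applied. -/
def leviCivita (g : SmoothMetric E M) (Y : (x : M) → TangentSpace 𝓘(ℝ, E) x) (x : M)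
    (v : TangentSpace 𝓘(ℝ, E) x) : TangentSpace 𝓘(ℝ, E) x :=
  sharp g x
    ((coordMetric g x (extChartAt 𝓘(ℝ, E) x x)
        (fderiv ℝ (coordField Y x) (extChartAt 𝓘(ℝ, E) x x) (chartDeriv x x v))
      + christoffelFirst g x (chartDeriv x x v) (chartDeriv x x (Y x))) ∘L chartDeriv x x)

theorem inner_leviCivita (g : SmoothMetric E M) (Y : (x : M) → TangentSpace 𝓘(ℝ, E) x) (x : M)
    (v w : TangentSpace 𝓘(ℝ, E) x) :
    g.inner x (leviCivita g Y x v) w =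
      coordMetric g x (extChartAt 𝓘(ℝ, E) x x)
        (fderiv ℝ (coordField Y x) (extChartAt 𝓘(ℝ, E) x x) (chartDeriv x x v))
        (chartDeriv x x w)
      + christoffelFirst g x (chartDeriv x x v) (chartDeriv x x (Y x)) (chartDeriv x x w) :=
  inner_sharp g x _ w

/-- The Hessian of `f` at `x`: the bilinear form `(v, w) ↦ ⟨∇_v grad f, w⟩` on `T_x M`. -/
def hess (g : SmoothMetric E M) (f : M → ℝ) (x : M) (v w : TangentSpace 𝓘(ℝ, E) x) : ℝ :=
  g.inner x (leviCivita g (grad g f) x v) w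

/-- The Gramian matrix of two families of functions at a point; the entry in row `a` and column `b`
is `⟨grad h_b, grad f_a⟩`. -/
def gramian (g : SmoothMetric E M) {r s : ℕ} (f : Fin r → M → ℝ) (h : Fin s → M → ℝ) (x : M) :
    Matrix (Fin r) (Fin s) ℝ :=
  Matrix.of fun a b ↦ g.inner x (grad g (h b) x) (grad g (f a) x)

/-- The multiplier functions `σ_i`: the quotient by the Gramian determinant of `(F_1, …, F_k)` of
the determinant of the Gramian whose lower family has `F_i` replaced by `G`. -/
def multiplier (g : SmoothMetric E M) {k : ℕ} (F : Fin k → M → ℝ) (G : M → ℝ) (i : Fin k)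
    (x : M) : ℝ :=
  (gramian g F (Function.update F i G) x).det / (gramian g F F x).det

/-- Smoothness of a vector field. -/
def IsSmoothVectorField (X : (x : M) → TangentSpace 𝓘(ℝ, E) x) : Prop :=
  ContMDiff 𝓘(ℝ, E) (𝓘(ℝ, E).tangent) ∞ (fun x ↦ (⟨x, X x⟩ : TangentBundle 𝓘(ℝ, E) M))

end Riemannian

/-- `c` is a regular value of `F : M → ℝ^k`: the differential of `F` is onto at each point of the
fibre over `c`. -/
def IsRegularValue {E : Type*} [NormedAddCommGroup E] [NormedSpace ℝ E]
    {M : Type*} [TopologicalSpace M] [ChartedSpace E M] {k : ℕ}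
    (F : M → EuclideanSpace ℝ (Fin k)) (c : EuclideanSpace ℝ (Fin k)) : Prop :=
  ∀ x : M, F x = c →
    Function.Surjective (mfderiv 𝓘(ℝ, E) 𝓘(ℝ, EuclideanSpace ℝ (Fin k)) F x)

/-- The tangent space `T_x S`, as a subspace of `T_x M`, of a submanifold `S` of `M`: the image of
the differential of the inclusion. -/
def tangentSubspace {E E' : Type*} [NormedAddCommGroup E] [NormedSpace ℝ E]
    [NormedAddCommGroup E'] [NormedSpace ℝ E']
    {M : Type*} [TopologicalSpace M] [ChartedSpace E M] {S : Set M} [ChartedSpace E' S] (x : S) :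
    Submodule ℝ (TangentSpace 𝓘(ℝ, E) (x : M)) :=
  (mfderiv 𝓘(ℝ, E') 𝓘(ℝ, E) (Subtype.val : S → M) x).range

/-- `x` is a (Lyapunov) stable equilibrium of the vector field `X` on the manifold `N`: `X` vanishes
at `x`, and for each neighbourhood `U` of `x` there is a neighbourhood `V` of `x` such that from
each point of `V` there starts a solution defined for all times `t ≥ 0`, and all solutions
that start in `V`, on whatever interval `[0, T)`, stay in `U`. -/
def IsStableEquilibrium {E : Type*} [NormedAddCommGroup E] [NormedSpace ℝ E]
    {N : Type*} [TopologicalSpace N] [ChartedSpace E N]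
    (X : (x : N) → TangentSpace 𝓘(ℝ, E) x) (x : N) : Prop :=
  X x = 0 ∧ ∀ U ∈ 𝓝 x, ∃ V ∈ 𝓝 x, ∀ y ∈ V,
    (∃ γ : ℝ → N, γ 0 = y ∧ IsMIntegralCurveOn γ X (Ici 0)) ∧
    ∀ (γ : ℝ → N) (T : ℝ), γ 0 = y → IsMIntegralCurveOn γ X (Ico 0 T) → ∀ t ∈ Ico 0 T, γ t ∈ U

end ConstrainedStability

end

/-! On `S` the components `F_i` are constant, so `G` restricted to `S` differs by a constant from
the Lagrangian `L = G - ∑ σ_i(x_e) F_i`, with the multipliers frozen at `x_e`. By (ii) the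
differential of `L` vanishes at `x_e` on all of `TM`. At a critical point the Hessian is the plain
second derivative in any chart, since the metric corrections are linear in the gradient
(`hess_eq_fderiv_fderiv`, `hess_sub_sum_eq`), and pulling it back along the inclusion creates no
second-order term of the inclusion. So (iii) says that `G` restricted to `S` has positive definite
second derivative at `x_e`, which is thus a strict local minimum (`eventually_lt_of_hess_pos`).

By (i), `G` does not increase along `X_S`, so it is a Lyapunov function
(`isStableEquilibrium_of_strict_local_min`): a solution that starts below the minimum of `G` on the
frontier of a small compact neighbourhood cannot cross it (`mem_interior_of_le_initial`). Existence
for all times comes from cutting the field off in a chart. -/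

/-! ### Analysis on vector spaces: second derivative test, exit argument, complete fields -/

section Analysis

open Filter

variable {V : Type*} [NormedAddCommGroup V] [NormedSpace ℝ V] [FiniteDimensional ℝ V]

/-- A positive definite bilinear form on a finite-dimensional space is coercive. -/
theorem exists_pos_mul_norm_sq_le_of_pos (A : V →L[ℝ] V →L[ℝ] ℝ)
    (hA : ∀ u, u ≠ 0 → 0 < A u u) : ∃ c > 0, ∀ u, c * ‖u‖ ^ 2 ≤ A u u := by
  have hcont : Continuous fun u ↦ A u u := A.continuous.clm_apply continuous_id
  -- The sphere is empty only when `V` is trivial; any constant then works.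
  rcases (Metric.sphere (0 : V) 1).eq_empty_or_nonempty with he | hne
  · refine ⟨1, one_pos, fun u ↦ ?_⟩
    rcases eq_or_ne u 0 with rfl | hu
    · simp
    · have : ‖u‖⁻¹ • u ∈ Metric.sphere (0 : V) 1 := by
        simp [norm_smul, inv_mul_cancel₀ (norm_ne_zero_iff.2 hu)]
      simp [he] at this
  · obtain ⟨w, hw, hmin⟩ := (isCompact_sphere (0 : V) 1).exists_isMinOn hne hcont.continuousOn
    have hw0 : w ≠ 0 := by
      rintro rfl
      simp at hw
    refine ⟨A w w, hA w hw0, fun u ↦ ?_⟩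
    rcases eq_or_ne u 0 with rfl | hu
    · simp
    have hn : ‖u‖ ≠ 0 := norm_ne_zero_iff.2 hu
    have hmem : ‖u‖⁻¹ • u ∈ Metric.sphere (0 : V) 1 := by
      simp [norm_smul, inv_mul_cancel₀ hn]
    have h : A w w ≤ A (‖u‖⁻¹ • u) (‖u‖⁻¹ • u) := hmin hmem
    simp only [map_smul, smul_apply, smul_eq_mul] at h
    have hp : 0 < ‖u‖ := norm_pos_iff.2 hu
    calc A w w * ‖u‖ ^ 2 ≤ ‖u‖⁻¹ * (‖u‖⁻¹ * A u u) * ‖u‖ ^ 2 := by gcongr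
      _ = A u u := by field_simp

/-- The second derivative test, for a strict local minimum. -/
theorem eventually_lt_of_hasFDerivAt_pos {h : V → ℝ} {h' : V → V →L[ℝ] ℝ}
    {A : V →L[ℝ] V →L[ℝ] ℝ} {q₀ : V} (hh : ∀ᶠ q in 𝓝 q₀, HasFDerivAt h (h' q) q)
    (h₀ : h' q₀ = 0) (hA : HasFDerivAt h' A q₀) (hpos : ∀ u, u ≠ 0 → 0 < A u u) :
    ∀ᶠ q in 𝓝 q₀, q ≠ q₀ → h q₀ < h q := by
  obtain ⟨c, hc, hcA⟩ := exists_pos_mul_norm_sq_le_of_pos A hpos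
  have hlo := hA.isLittleO.def (half_pos hc)
  obtain ⟨r, hr, hball⟩ := Metric.eventually_nhds_iff_ball.1 (hh.and hlo)
  -- Coercivity gives `c ‖q - q₀‖²`; the linearisation error of `h'` consumes at most half of it.
  have key : ∀ q ∈ Metric.ball q₀ r, q ≠ q₀ → 0 < h' q (q - q₀) := by
    intro q hq hne
    have h1 := (hball q hq).2
    rw [h₀, sub_zero] at h1
    have hp : 0 < ‖q - q₀‖ := norm_pos_iff.2 (sub_ne_zero.2 hne)
    have h2 : |(h' q - A (q - q₀)) (q - q₀)| ≤ c / 2 * ‖q - q₀‖ * ‖q - q₀‖ :=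
      ((h' q - A (q - q₀)).le_opNorm (q - q₀)).trans (by gcongr)
    have h3 := hcA (q - q₀)
    have h4 := (abs_le.1 h2).1
    rw [sub_apply] at h4
    have : 0 < c * ‖q - q₀‖ ^ 2 := by positivity
    nlinarith
  filter_upwards [Metric.ball_mem_nhds q₀ hr] with q hq hne
  set u := q - q₀ with hu
  have hmem : ∀ t ∈ Icc (0 : ℝ) 1, q₀ + t • u ∈ Metric.ball q₀ r := by
    intro t ht
    rw [Metric.mem_ball, dist_eq_norm] at hq ⊢
    rw [add_sub_cancel_left, norm_smul, Real.norm_of_nonneg ht.1]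
    exact (mul_le_of_le_one_left (norm_nonneg _) ht.2).trans_lt hq
  have hline : ∀ t : ℝ, HasDerivAt (fun t : ℝ ↦ q₀ + t • u) u t := fun t ↦ by
    simpa using ((hasDerivAt_id t).smul_const u).const_add q₀
  have hder : ∀ t ∈ Icc (0 : ℝ) 1,
      HasDerivAt (fun t : ℝ ↦ h (q₀ + t • u)) (h' (q₀ + t • u) u) t := fun t ht ↦
    ((hball _ (hmem t ht)).1).comp_hasDerivAt t (hline t)
  have hmono : StrictMonoOn (fun t : ℝ ↦ h (q₀ + t • u)) (Icc 0 1) := by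
    refine strictMonoOn_of_deriv_pos (convex_Icc 0 1)
      (fun t ht ↦ (hder t ht).continuousAt.continuousWithinAt) fun t ht ↦ ?_
    rw [interior_Icc] at ht
    have ht' : t ∈ Icc (0 : ℝ) 1 := Ioo_subset_Icc_self ht
    rw [(hder t ht').deriv]
    have hu0 : u ≠ 0 := sub_ne_zero.2 hne
    have := key _ (hmem t ht') (by simp [ht.1.ne', hu0])
    rw [add_sub_cancel_left, map_smul, smul_eq_mul] at this
    exact pos_of_mul_pos_right this ht.1.le
  have := hmono (left_mem_Icc.2 zero_le_one) (right_mem_Icc.2 zero_le_one) zero_lt_one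
  simpa [hu] using this

/-- A curve that starts in the interior of a closed set `K`, below the values which `f` takes on the
frontier of `K`, cannot leave `K` if `f` does not exceed its initial value along it. -/
theorem mem_interior_of_le_initial {N : Type*} [TopologicalSpace N] {K : Set N} (hK : IsClosed K)
    {f : N → ℝ} {m : ℝ} (hm : ∀ y ∈ frontier K, m ≤ f y) {γ : ℝ → N} {T : ℝ} (hT : 0 ≤ T)
    (hγ : ContinuousOn γ (Icc 0 T)) (h0 : γ 0 ∈ interior K) (hf0 : f (γ 0) < m)
    (hle : ∀ t ∈ Icc 0 T, (∀ s ∈ Icc 0 t, γ s ∈ K) → f (γ t) ≤ f (γ 0)) :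
    γ T ∈ interior K := by
  by_contra hcon
  have hclosed : IsClosed (Icc 0 T ∩ γ ⁻¹' (interior K)ᶜ) :=
    hγ.preimage_isClosed_of_isClosed isClosed_Icc isOpen_interior.isClosed_compl
  have hcomp : IsCompact (Icc 0 T ∩ γ ⁻¹' (interior K)ᶜ) :=
    isCompact_Icc.of_isClosed_subset hclosed inter_subset_left
  -- `s` is the first time outside the interior; closedness of `K` puts `γ s` on the frontier.
  obtain ⟨s, ⟨hsT, hsK⟩, hmin⟩ := hcomp.exists_isLeast ⟨T, ⟨hT, le_rfl⟩, hcon⟩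
  have hlt : ∀ t ∈ Ico 0 s, γ t ∈ interior K := by
    intro t ht
    by_contra h
    exact absurd (hmin ⟨⟨ht.1, ht.2.le.trans hsT.2⟩, h⟩) (not_le.2 ht.2)
  have hs0 : 0 < s := by
    refine hsT.1.lt_of_ne ?_
    rintro rfl
    exact hsK h0
  have hcl : γ s ∈ K := by
    have hc : ContinuousWithinAt γ (Ico 0 s) s :=
      (hγ s hsT).mono fun t ht ↦ ⟨ht.1, ht.2.le.trans hsT.2⟩
    have : s ∈ closure (Ico 0 s) := by
      rw [closure_Ico hs0.ne]
      exact right_mem_Icc.2 hs0.le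
    exact hK.closure_subset_iff.2 interior_subset (hc.mem_closure this hlt)
  have hfr : γ s ∈ frontier K := by
    rw [hK.frontier_eq]
    exact ⟨hcl, hsK⟩
  -- `hle` presupposes only that the curve has stayed in `K` so far; this admits solutions of a
  -- cut-off field, which solve the original equation only there.
  have hall : ∀ t ∈ Icc 0 s, γ t ∈ K := by
    intro t ht
    rcases ht.2.eq_or_lt with rfl | h
    · exact hcl
    · exact interior_subset (hlt t ⟨ht.1, h⟩)
  linarith [hm _ hfr, hle s hsT hall]

/-- A compactly supported `C¹` vector field on a vector space is complete. -/
theorem exists_forall_hasDerivAt_of_hasCompactSupport {v : V → V} (hv : ContDiff ℝ 1 v)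
    (hsupp : HasCompactSupport v) (x : V) :
    ∃ β : ℝ → V, β 0 = x ∧ ∀ t, HasDerivAt β (v (β t)) t := by
  have : CompleteSpace V := FiniteDimensional.complete ℝ V
  obtain ⟨K, hK⟩ := ContDiff.lipschitzWith_of_hasCompactSupport hsupp hv one_ne_zero
  obtain ⟨C, hC⟩ := hsupp.exists_bound_of_continuous hv.continuous
  have hC0 : 0 ≤ C := (norm_nonneg _).trans (hC x)
  lift C to NNReal using hC0
  have hvM : ContMDiff 𝓘(ℝ, V) (𝓘(ℝ, V).tangent) 1
      (fun x ↦ (⟨x, v x⟩ : TangentBundle 𝓘(ℝ, V) V)) :=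
    fun x ↦ contMDiffAt_vectorSpace_iff_contDiffAt.2 hv.contDiffAt
  obtain ⟨β, hβ0, hβ⟩ := (exists_isMIntegralCurve_iff_exists_isMIntegralCurveOn_Ioo hvM x).2 <| by
    intro a
    have h0 : (0 : ℝ) ∈ Icc (-|a|) |a| := ⟨by simp, by simp⟩
    -- Speed at most `C` during time `|a|` confines the solution to radius `C |a|`. The Lipschitz
    -- constant is global, so this radius restricts nothing.
    have hPL : IsPicardLindelof (fun _ ↦ v) (⟨0, h0⟩ : Icc (-|a|) |a|) x
        (C * ‖a‖₊) 0 C K :=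
      { lipschitzOnWith := fun t _ ↦ hK.lipschitzOnWith
        continuousOn := fun y _ ↦ continuousOn_const
        norm_le := fun t _ y _ ↦ hC y
        mul_max_le := by simp }
    obtain ⟨α, hα0, hα⟩ := hPL.exists_eq_forall_mem_Icc_hasDerivWithinAt₀
    refine ⟨α, hα0, fun t ht ↦ HasMFDerivAt.hasMFDerivWithinAt ?_⟩
    have ht' : t ∈ Ioo (-|a|) |a| :=
      ⟨(neg_le_neg (le_abs_self a)).trans_lt ht.1, ht.2.trans_le (le_abs_self a)⟩
    have := (hα t (Ioo_subset_Icc_self ht')).hasDerivAt (Icc_mem_nhds ht'.1 ht'.2)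
    exact this.hasFDerivAt.hasMFDerivAt
  refine ⟨β, hβ0, fun t ↦ ?_⟩
  have h : HasFDerivAt β ((1 : ℝ →L[ℝ] ℝ).smulRight (v (β t))) t := (hβ t).hasFDerivAt
  simpa using h.hasDerivAt

end Analysis

namespace ConstrainedStability

open Filter

/-! ### Monotonicity along integral curves -/

section Manifold

variable {E : Type*} [NormedAddCommGroup E] [NormedSpace ℝ E]
  {M : Type*} [TopologicalSpace M] [ChartedSpace E M]

/-- A function whose derivative along a vector field is nonpositive does not increase along the
integral curves. -/
theorem le_of_isMIntegralCurveOn {X : (x : M) → TangentSpace 𝓘(ℝ, E) x} {f : M → ℝ}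
    (hf : MDifferentiable 𝓘(ℝ, E) 𝓘(ℝ, ℝ) f) (hX : ∀ x, mvfderiv 𝓘(ℝ, E) f x (X x) ≤ 0)
    {γ : ℝ → M} {t : ℝ} (ht : 0 ≤ t) (hγ : IsMIntegralCurveOn γ X (Icc 0 t)) :
    f (γ t) ≤ f (γ 0) := by
  have hder : ∀ s ∈ Icc 0 t, HasDerivWithinAt (f ∘ γ) (mvfderiv 𝓘(ℝ, E) f (γ s) (X (γ s)))
      (Icc 0 t) s := by
    intro s hs
    have h := (hf (γ s)).hasMFDerivAt.comp_hasMFDerivWithinAt s (hγ s hs)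
    have h2 : HasFDerivWithinAt (f ∘ γ) ((mvfderiv 𝓘(ℝ, E) f (γ s)).comp
        ((1 : ℝ →L[ℝ] ℝ).smulRight (X (γ s)))) (Icc 0 t) s := h.hasFDerivWithinAt
    refine h2.hasDerivWithinAt.congr_deriv ?_
    change mvfderiv 𝓘(ℝ, E) f (γ s) ((1 : ℝ) • X (γ s)) = _
    rw [one_smul]
  have hanti : AntitoneOn (f ∘ γ) (Icc 0 t) := by
    refine antitoneOn_of_hasDerivWithinAt_nonpos (convex_Icc 0 t)
      (fun s hs ↦ (hder s hs).continuousWithinAt)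
      (fun s hs ↦ (hder s (interior_subset hs)).mono interior_subset) fun s _ ↦ hX _
  exact hanti (left_mem_Icc.2 ht) (right_mem_Icc.2 ht) ht

theorem coordField_extChartAt_self (X : (x : M) → TangentSpace 𝓘(ℝ, E) x) (x : M) :
    coordField X x (extChartAt 𝓘(ℝ, E) x x) = chartDeriv x x (X x) := by
  -- The base point occurs in the type of the vector, so it is generalised before the equality is
  -- substituted.
  have : ∀ y, y = x → (chartDeriv x y (X y) : E) = chartDeriv x x (X x) := by
    rintro _ rfl
    rfl
  exact this _ (extChartAt_to_inv x)

end Manifold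

/-! ### Vector fields and functions in charts -/

section Charts

variable {E : Type*} [NormedAddCommGroup E] [NormedSpace ℝ E]
  {M : Type*} [TopologicalSpace M] [ChartedSpace E M] [IsManifold 𝓘(ℝ, E) ∞ M]

theorem contMDiffAt_extChartAt_symm {x : M} {p : E} (hp : p ∈ (extChartAt 𝓘(ℝ, E) x).target) :
    ContMDiffAt 𝓘(ℝ, E) 𝓘(ℝ, E) ∞ (extChartAt 𝓘(ℝ, E) x).symm p :=
  (contMDiffOn_extChartAt_symm x).contMDiffAt ((isOpen_extChartAt_target x).mem_nhds hp)

theorem mdifferentiableAt_extChartAt_symm {x : M} {p : E} (hp : p ∈ (extChartAt 𝓘(ℝ, E) x).target) :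
    MDifferentiableAt 𝓘(ℝ, E) 𝓘(ℝ, E) (extChartAt 𝓘(ℝ, E) x).symm p :=
  (contMDiffAt_extChartAt_symm hp).mdifferentiableAt (by simp)

theorem chartDeriv_chartSymmDeriv {x : M} {p : E} (hp : p ∈ (extChartAt 𝓘(ℝ, E) x).target) (a : E) :
    chartDeriv x _ (chartSymmDeriv x p a) = a := by
  have : IsManifold 𝓘(ℝ, E) 1 M := IsManifold.of_le (n := ∞) (by simp)
  have h := mfderiv_extChartAt_comp_mfderivWithin_extChartAt_symm hp
  simp only [modelWithCornersSelf_coe, range_id, mfderivWithin_univ] at h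
  exact DFunLike.congr_fun h a

theorem chartSymmDeriv_chartDeriv {x : M} {p : E} (hp : p ∈ (extChartAt 𝓘(ℝ, E) x).target)
    (v : TangentSpace 𝓘(ℝ, E) ((extChartAt 𝓘(ℝ, E) x).symm p)) :
    chartSymmDeriv x p (chartDeriv x _ v) = v := by
  have : IsManifold 𝓘(ℝ, E) 1 M := IsManifold.of_le (n := ∞) (by simp)
  have h := mfderivWithin_extChartAt_symm_comp_mfderiv_extChartAt hp
  simp only [modelWithCornersSelf_coe, range_id, mfderivWithin_univ] at h
  exact DFunLike.congr_fun h v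

/-- The coordinate vector field with constant coordinates `a` is smooth along the inverse chart. -/
theorem contMDiffAt_chartSymmDeriv {x : M} {p : E} (hp : p ∈ (extChartAt 𝓘(ℝ, E) x).target) (a : E) :
    ContMDiffAt 𝓘(ℝ, E) (𝓘(ℝ, E).tangent) 1
      (fun q ↦ (⟨(extChartAt 𝓘(ℝ, E) x).symm q, chartSymmDeriv x q a⟩ : TangentBundle 𝓘(ℝ, E) M))
      p := by
  have hopen := isOpen_extChartAt_target (I := 𝓘(ℝ, E)) x
  -- The field is the tangent map of the inverse chart applied to the constant section `q ↦ (q, a)`.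
  have h := (contMDiffOn_extChartAt_symm (I := 𝓘(ℝ, E)) (n := ∞) x).contMDiffOn_tangentMapWithin
    (m := 1) (by rw [one_add_one_eq_two]; exact ENat.LEInfty.out) hopen.uniqueMDiffOn
  have hs : ContMDiff 𝓘(ℝ, E) (𝓘(ℝ, E).tangent) 1
      (fun q : E ↦ (⟨q, a⟩ : TangentBundle 𝓘(ℝ, E) E)) := fun q ↦
    contMDiffAt_vectorSpace_iff_contDiffAt.2 contDiffAt_const
  have h2 := h.comp (hs.contMDiffOn (s := (extChartAt 𝓘(ℝ, E) x).target)) (fun q hq ↦ hq)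
  refine (h2.contMDiffAt (hopen.mem_nhds hp)).congr_of_eventuallyEq ?_
  filter_upwards [hopen.mem_nhds hp] with q hq
  simp only [Function.comp, tangentMapWithin, mfderivWithin_of_isOpen hopen hq]
  rfl

theorem mvfderiv_chartSymmDeriv {f : M → ℝ} {x : M} {p : E} (hp : p ∈ (extChartAt 𝓘(ℝ, E) x).target)
    (hf : MDifferentiableAt 𝓘(ℝ, E) 𝓘(ℝ, ℝ) f ((extChartAt 𝓘(ℝ, E) x).symm p)) (a : E) :
    mvfderiv 𝓘(ℝ, E) f _ (chartSymmDeriv x p a) =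
      fderiv ℝ (f ∘ (extChartAt 𝓘(ℝ, E) x).symm) p a := by
  have h := mfderiv_comp_apply p hf (mdifferentiableAt_extChartAt_symm hp) a
  rw [mfderiv_eq_fderiv] at h
  exact h.symm

/-- The coordinate expression of a smooth vector field is continuously differentiable. -/
theorem contDiffOn_coordField {X : (x : M) → TangentSpace 𝓘(ℝ, E) x} (hX : IsSmoothVectorField X)
    (x : M) : ContDiffOn ℝ 1 (coordField X x) (extChartAt 𝓘(ℝ, E) x).target := by
  have hopen := isOpen_extChartAt_source (I := 𝓘(ℝ, E)) x
  have h := (contMDiffOn_extChartAt (I := 𝓘(ℝ, E)) (n := ∞) (x := x)).contMDiffOn_tangentMapWithin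
    (m := 1) (by rw [one_add_one_eq_two]; exact ENat.LEInfty.out)
    (by simpa using hopen.uniqueMDiffOn)
  have hs := (hX.of_le (m := 1) (by simp)).comp_contMDiffOn
    ((contMDiffOn_extChartAt_symm (I := 𝓘(ℝ, E)) (n := ∞) x).of_le (m := 1) (by simp))
  have h2 := h.comp hs fun q hq ↦ by simpa using (extChartAt 𝓘(ℝ, E) x).map_target hq
  refine (contMDiffOn_vectorSpace_iff_contDiffOn (V := coordField X x)).1 (h2.congr fun q hq ↦ ?_)
  have hsrc : (extChartAt 𝓘(ℝ, E) x).symm q ∈ (chartAt E x).source := by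
    simpa using (extChartAt 𝓘(ℝ, E) x).map_target hq
  simp only [Function.comp, tangentMapWithin,
    mfderivWithin_of_isOpen (chartAt E x).open_source hsrc]
  have : ∀ (z : E) (w : E), z = q →
      (⟨q, w⟩ : TangentBundle 𝓘(ℝ, E) E) = (⟨z, w⟩ : TangentBundle 𝓘(ℝ, E) E) := by
    rintro z w rfl
    rfl
  exact this _ _ ((extChartAt 𝓘(ℝ, E) x).right_inv hq)

/-- A solution of an ordinary differential equation in coordinates gives an integral curve. -/
theorem isMIntegralCurveOn_extChartAt_symm_comp {X : (x : M) → TangentSpace 𝓘(ℝ, E) x} {x : M}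
    {β : ℝ → E} {s : Set ℝ} (hs : ∀ t ∈ s, β t ∈ (extChartAt 𝓘(ℝ, E) x).target)
    (hβ : ∀ t ∈ s, HasDerivAt β (coordField X x (β t)) t) :
    IsMIntegralCurveOn ((extChartAt 𝓘(ℝ, E) x).symm ∘ β) X s := by
  intro t ht
  have h := (mdifferentiableAt_extChartAt_symm (hs t ht)).hasMFDerivAt.comp t
    (hβ t ht).hasFDerivAt.hasMFDerivAt
  refine (h.congr_mfderiv ?_).hasMFDerivWithinAt
  ext
  change chartSymmDeriv x (β t) ((1 : ℝ) • coordField X x (β t)) =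
    (1 : ℝ) • X ((extChartAt 𝓘(ℝ, E) x).symm (β t))
  rw [one_smul, one_smul]
  exact chartSymmDeriv_chartDeriv (hs t ht) _

theorem contDiffOn_comp_extChartAt_symm {f : M → ℝ} (hf : ContMDiff 𝓘(ℝ, E) 𝓘(ℝ, ℝ) 2 f) (x : M) :
    ContDiffOn ℝ 2 (f ∘ (extChartAt 𝓘(ℝ, E) x).symm) (extChartAt 𝓘(ℝ, E) x).target := by
  rw [← contMDiffOn_iff_contDiffOn]
  exact hf.comp_contMDiffOn ((contMDiffOn_extChartAt_symm x).of_le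
    ENat.LEInfty.out)

theorem differentiableAt_fderiv_comp_extChartAt_symm {f : M → ℝ}
    (hf : ContMDiff 𝓘(ℝ, E) 𝓘(ℝ, ℝ) 2 f) {x : M} {p : E} (hp : p ∈ (extChartAt 𝓘(ℝ, E) x).target) :
    DifferentiableAt ℝ (fderiv ℝ (f ∘ (extChartAt 𝓘(ℝ, E) x).symm)) p :=
  (((contDiffOn_comp_extChartAt_symm hf x).contDiffAt
    ((isOpen_extChartAt_target x).mem_nhds hp)).fderiv_right (m := 1)
      (by rw [one_add_one_eq_two])).differentiableAt one_ne_zero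

end Charts

/-! ### Metric, gradient and Hessian in coordinates -/

section Metric

variable {E : Type*} [NormedAddCommGroup E] [NormedSpace ℝ E] [FiniteDimensional ℝ E]
  {M : Type*} [TopologicalSpace M] [ChartedSpace E M] [IsManifold 𝓘(ℝ, E) ∞ M]

/-- The metric, read in a chart, is continuously differentiable. -/
theorem contDiffOn_coordMetric (g : SmoothMetric E M) (x : M) :
    ContDiffOn ℝ 1 (coordMetric g x) (extChartAt 𝓘(ℝ, E) x).target := by
  refine contDiffOn_clm_apply.2 fun a ↦ contDiffOn_clm_apply.2 fun b p hp ↦ ?_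
  have hg : ContMDiffAt 𝓘(ℝ, E) (𝓘(ℝ, E).prod 𝓘(ℝ, E →L[ℝ] E →L[ℝ] ℝ)) 1
      (fun q ↦ Bundle.TotalSpace.mk' (E →L[ℝ] E →L[ℝ] ℝ)
        (E := fun x : M ↦ TangentSpace 𝓘(ℝ, E) x →L[ℝ] TangentSpace 𝓘(ℝ, E) x →L[ℝ] ℝ)
        ((extChartAt 𝓘(ℝ, E) x).symm q) (g.inner ((extChartAt 𝓘(ℝ, E) x).symm q))) p :=
    ((g.contMDiff.of_le (by simp)).contMDiffAt).comp p
      ((contMDiffAt_extChartAt_symm hp).of_le (by simp))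
  have h := hg.clm_bundle_apply₂ (F₁ := E) (F₂ := E) (F₃ := ℝ)
    (E₃ := fun _ : M ↦ ℝ)
    (contMDiffAt_chartSymmDeriv hp a) (contMDiffAt_chartSymmDeriv hp b)
  rw [Bundle.contMDiffAt_totalSpace] at h
  exact h.2.contDiffAt.contDiffWithinAt

/-- Positivity makes the map injective, and `E` and its dual have equal dimension. The inverse is
what raises the index of a differential. -/
theorem isInvertible_coordMetric (g : SmoothMetric E M) {x : M} {p : E}
    (hp : p ∈ (extChartAt 𝓘(ℝ, E) x).target) : (coordMetric g x p).IsInvertible := by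
  have hinj : Function.Injective (coordMetric g x p).toLinearMap := by
    refine LinearMap.ker_eq_bot.1 ((LinearMap.ker_eq_bot').2 fun a ha ↦ ?_)
    by_contra hne
    have h0 : chartSymmDeriv x p a ≠ 0 := by
      intro h
      rw [← chartDeriv_chartSymmDeriv hp a, h, map_zero] at hne
      exact hne rfl
    have h := g.pos _ _ h0
    rw [← coordMetric_apply] at h
    have h1 : coordMetric g x p a = 0 := ha
    simp [h1] at h
  have hdim : Module.finrank ℝ E = Module.finrank ℝ (E →L[ℝ] ℝ) := by
    rw [← (LinearMap.toContinuousLinearMap (𝕜 := ℝ) (E := E) (F' := ℝ)).finrank_eq]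
    exact Subspace.dual_finrank_eq.symm
  refine ⟨(LinearEquiv.ofInjectiveOfFinrankEq _ hinj hdim).toContinuousLinearEquiv, ?_⟩
  ext a b
  rfl

variable {f : M → ℝ}

/-- In coordinates, lowering the index of the gradient gives the differential. -/
theorem coordMetric_coordField_grad (g : SmoothMetric E M) {x : M} {p : E}
    (hp : p ∈ (extChartAt 𝓘(ℝ, E) x).target)
    (hf : MDifferentiableAt 𝓘(ℝ, E) 𝓘(ℝ, ℝ) f ((extChartAt 𝓘(ℝ, E) x).symm p)) :
    coordMetric g x p (coordField (grad g f) x p) =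
      fderiv ℝ (f ∘ (extChartAt 𝓘(ℝ, E) x).symm) p := by
  ext a
  rw [coordMetric_apply, coordField, chartSymmDeriv_chartDeriv hp, grad, inner_sharp,
    mvfderiv_chartSymmDeriv hp hf]

/-- Near `p` the gradient is the inverse metric applied to the differential of `f`, and both factors
are differentiable. -/
theorem differentiableAt_coordField_grad (g : SmoothMetric E M)
    (hf : ContMDiff 𝓘(ℝ, E) 𝓘(ℝ, ℝ) 2 f) {x : M} {p : E}
    (hp : p ∈ (extChartAt 𝓘(ℝ, E) x).target) :
    DifferentiableAt ℝ (coordField (grad g f) x) p := by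
  have : CompleteSpace E := FiniteDimensional.complete ℝ E
  have hn := (isOpen_extChartAt_target (I := 𝓘(ℝ, E)) x).mem_nhds hp
  have hinv : DifferentiableAt ℝ (fun q ↦ (coordMetric g x q).inverse) p := by
    obtain ⟨e, he⟩ := isInvertible_coordMetric g hp
    have h := contDiffAt_map_inverse (𝕜 := ℝ) (n := 1) e
    rw [he] at h
    exact (h.differentiableAt one_ne_zero).comp p
      (((contDiffOn_coordMetric g x).contDiffAt hn).differentiableAt one_ne_zero)
  refine (hinv.clm_apply
    (differentiableAt_fderiv_comp_extChartAt_symm hf hp)).congr_of_eventuallyEq ?_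
  filter_upwards [hn] with q hq
  rw [← coordMetric_coordField_grad g hq (hf.mdifferentiableAt two_ne_zero)]
  obtain ⟨e, he⟩ := isInvertible_coordMetric g hq
  rw [← he, ContinuousLinearMap.inverse_equiv]
  simp

/-- The Hessian in coordinates: the second derivative, up to terms which are linear in the
gradient. -/
theorem hess_eq_fderiv_fderiv (g : SmoothMetric E M) (hf : ContMDiff 𝓘(ℝ, E) 𝓘(ℝ, ℝ) 2 f) (x : M)
    (v w : TangentSpace 𝓘(ℝ, E) x) :
    hess g f x v w =
      fderiv ℝ (fderiv ℝ (f ∘ (extChartAt 𝓘(ℝ, E) x).symm)) (extChartAt 𝓘(ℝ, E) x x)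
        (chartDeriv x x v) (chartDeriv x x w)
      + (christoffelFirst g x (chartDeriv x x v) (chartDeriv x x (grad g f x)) (chartDeriv x x w)
        - fderiv ℝ (coordMetric g x) (extChartAt 𝓘(ℝ, E) x x)
          (chartDeriv x x v) (chartDeriv x x (grad g f x)) (chartDeriv x x w)) := by
  have hp := mem_extChartAt_target (I := 𝓘(ℝ, E)) x
  have hn := (isOpen_extChartAt_target (I := 𝓘(ℝ, E)) x).mem_nhds hp
  have hD := (((contDiffOn_coordMetric g x).contDiffAt hn).differentiableAt one_ne_zero).hasFDerivAt
  have h := hD.clm_apply (differentiableAt_coordField_grad g hf hp).hasFDerivAt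
  -- Differentiating this identity by the product rule trades the derivative of the gradient for the
  -- second derivative of `f`, at the cost of a term with the derivative of the metric.
  have heq : (fun q ↦ coordMetric g x q (coordField (grad g f) x q)) =ᶠ[𝓝 (extChartAt 𝓘(ℝ, E) x x)]
      fderiv ℝ (f ∘ (extChartAt 𝓘(ℝ, E) x).symm) := by
    filter_upwards [hn] with q hq
    exact coordMetric_coordField_grad g hq (hf.mdifferentiableAt two_ne_zero)
  rw [hess, inner_leviCivita, ← heq.fderiv_eq, h.fderiv, coordField_extChartAt_self]
  simp only [ContinuousLinearMap.comp_apply, ContinuousLinearMap.flip_apply, add_apply]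
  ring

end Metric

/-! ### Lyapunov's theorem -/

section Lyapunov

variable {E : Type*} [NormedAddCommGroup E] [NormedSpace ℝ E] [FiniteDimensional ℝ E]
  {N : Type*} [TopologicalSpace N] [ChartedSpace E N] [IsManifold 𝓘(ℝ, E) ∞ N] [T2Space N]

/-- Lyapunov's stability theorem on a manifold: an equilibrium is stable if it is a strict local
minimum of a function which does not increase along the vector field. -/
theorem isStableEquilibrium_of_strict_local_min {X : (x : N) → TangentSpace 𝓘(ℝ, E) x}
    (hX : IsSmoothVectorField X) {x₀ : N} (hx₀ : X x₀ = 0) {h : N → ℝ}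
    (hh : MDifferentiable 𝓘(ℝ, E) 𝓘(ℝ, ℝ) h) (hXh : ∀ x, mvfderiv 𝓘(ℝ, E) h x (X x) ≤ 0)
    (hmin : ∀ᶠ y in 𝓝 x₀, y ≠ x₀ → h x₀ < h y) : IsStableEquilibrium X x₀ := by
  refine ⟨hx₀, fun U hU ↦ ?_⟩
  set ψ := extChartAt 𝓘(ℝ, E) x₀ with hψ
  have hopen : IsOpen ψ.target := isOpen_extChartAt_target x₀
  have hq₀ : ψ x₀ ∈ ψ.target := mem_extChartAt_target x₀
  have hinv : ψ.symm (ψ x₀) = x₀ := extChartAt_to_inv x₀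
  have hcont : ContinuousOn ψ.symm ψ.target := continuousOn_extChartAt_symm x₀
  have htend : Tendsto ψ.symm (𝓝 (ψ x₀)) (𝓝 x₀) := by
    have := (hcont.continuousAt (hopen.mem_nhds hq₀)).tendsto
    rwa [hinv] at this
  obtain ⟨R, hR, hRball⟩ := Metric.eventually_nhds_iff_ball.1
    ((hopen.eventually_mem hq₀).and ((htend.eventually hU).and (htend.eventually hmin)))
  -- Leaves room for the closed ball of radius `2 * r`, which supports the bump function below.
  set r := R / 3 with hr
  have hr0 : 0 < r := by positivity
  have hsub : Metric.closedBall (ψ x₀) r ⊆ ψ.target := fun q hq ↦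
    (hRball q (Metric.closedBall_subset_ball (by linarith) hq)).1
  set B := Metric.closedBall (ψ x₀) r with hB
  set K := ψ.symm '' B with hK
  have hKcomp : IsCompact K := (isCompact_closedBall _ _).image_of_continuousOn (hcont.mono hsub)
  have hKU : K ⊆ U := by
    rintro _ ⟨q, hq, rfl⟩
    exact (hRball q (Metric.closedBall_subset_ball (by linarith) hq)).2.1
  have hKmin : ∀ y ∈ K, y ≠ x₀ → h x₀ < h y := by
    rintro _ ⟨q, hq, rfl⟩
    exact (hRball q (Metric.closedBall_subset_ball (by linarith) hq)).2.2
  have hsource : K ⊆ ψ.source := by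
    rintro _ ⟨q, hq, rfl⟩
    exact ψ.map_target (hsub hq)
  have hKB : ∀ y ∈ K, ψ y ∈ B := by
    rintro _ ⟨q, hq, rfl⟩
    rwa [ψ.right_inv (hsub hq)]
  -- This makes `ψ.symm` carry the frontier of `B` into that of `K`, so the bound `m` serves both in
  -- the chart and on `N`.
  have hint : ∀ q ∈ ψ.target, ψ.symm q ∈ interior K → q ∈ interior B := by
    intro q hq hqK
    have ho : IsOpen (ψ.target ∩ ψ.symm ⁻¹' interior K) :=
      hcont.isOpen_inter_preimage hopen isOpen_interior
    refine interior_maximal (fun z hz ↦ ?_) ho ⟨hq, hqK⟩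
    rw [← ψ.right_inv hz.1]
    exact hKB _ (interior_subset hz.2)
  have hKnhds : K ∈ 𝓝 x₀ := by
    filter_upwards [(isOpen_extChartAt_source (I := 𝓘(ℝ, E)) x₀).mem_nhds (mem_extChartAt_source x₀),
      (continuousAt_extChartAt x₀).preimage_mem_nhds (Metric.closedBall_mem_nhds (ψ x₀) hr0)]
      with y hy hyB
    exact ⟨ψ y, hyB, ψ.left_inv hy⟩
  have hx₀int : x₀ ∈ interior K := mem_interior_iff_mem_nhds.2 hKnhds
  have hfr : IsCompact (frontier K) :=
    hKcomp.of_isClosed_subset isClosed_frontier hKcomp.isClosed.frontier_subset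
  obtain ⟨m, hm₀, hm⟩ : ∃ m, h x₀ < m ∧ ∀ y ∈ frontier K, m ≤ h y := by
    rcases (frontier K).eq_empty_or_nonempty with he | hne
    · exact ⟨h x₀ + 1, by linarith, by simp [he]⟩
    · obtain ⟨y, hy, hymin⟩ := hfr.exists_isMinOn hne hh.continuous.continuousOn
      refine ⟨h y, hKmin y (hKcomp.isClosed.frontier_subset hy) ?_, hymin⟩
      rintro rfl
      exact hy.2 hx₀int
  refine ⟨interior K ∩ h ⁻¹' Iio m, inter_mem (interior_mem_nhds.2 hKnhds)
    (hh.continuous.continuousAt.preimage_mem_nhds (Iio_mem_nhds hm₀)), fun y hy ↦ ⟨?_, ?_⟩⟩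
  -- The cut-off coordinate field is complete and agrees with the original on `B`, which its
  -- solution never leaves.
  · let χ : ContDiffBump (ψ x₀) := ⟨r, 2 * r, hr0, by linarith⟩
    have hsupp : tsupport χ ⊆ ψ.target := by
      rw [χ.tsupport_eq]
      exact fun q hq ↦ (hRball q (Metric.closedBall_subset_ball
        (by change 2 * r < R; linarith) hq)).1
    have hZ := contDiffOn_coordField hX x₀
    have hv : ContDiff ℝ 1 fun q ↦ χ q • coordField X x₀ q := by
      refine contDiff_iff_contDiffAt.2 fun q ↦ ?_
      by_cases hq : q ∈ ψ.target
      · exact χ.contDiffAt.smul (hZ.contDiffAt (hopen.mem_nhds hq))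
      · have : (fun q ↦ χ q • coordField X x₀ q) =ᶠ[𝓝 q] fun _ ↦ 0 := by
          filter_upwards [(isClosed_tsupport χ).isOpen_compl.mem_nhds fun h ↦ hq (hsupp h)]
            with z hz
          rw [image_eq_zero_of_notMem_tsupport hz, zero_smul]
        exact contDiffAt_const.congr_of_eventuallyEq this
    obtain ⟨β, hβ0, hβ⟩ := exists_forall_hasDerivAt_of_hasCompactSupport hv
      (χ.hasCompactSupport.smul_right) (ψ y)
    have hone : ∀ q ∈ B, χ q = 1 := fun q hq ↦ χ.one_of_mem_closedBall hq
    have hcurve : ∀ s : Set ℝ, (∀ t ∈ s, β t ∈ B) → IsMIntegralCurveOn (ψ.symm ∘ β) X s :=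
      fun s hs ↦ isMIntegralCurveOn_extChartAt_symm_comp (fun t ht ↦ hsub (hs t ht)) fun t ht ↦ by
        simpa [hone _ (hs t ht)] using hβ t
    have hysrc := hsource (interior_subset hy.1)
    have hstart : ψ.symm (β 0) = y := by rw [hβ0, ψ.left_inv hysrc]
    have hstay : ∀ t ∈ Ici (0 : ℝ), β t ∈ B := fun t ht ↦ interior_subset <|
      mem_interior_of_le_initial Metric.isClosed_closedBall (f := h ∘ ψ.symm) (m := m)
        (fun q hq ↦ hm _ ?_) ht (fun s _ ↦ (hβ s).continuousAt.continuousWithinAt)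
        (by
          refine hint _ ?_ (by rw [hstart]; exact hy.1)
          rw [hβ0]
          exact ψ.map_source hysrc)
        (by simpa only [Function.comp, hstart] using mem_Iio.1 hy.2)
        (fun s hs hsB ↦ le_of_isMIntegralCurveOn hh hXh hs.1 (hcurve _ hsB))
    · exact ⟨ψ.symm ∘ β, hstart, hcurve _ hstay⟩
    · rw [Metric.isClosed_closedBall.frontier_eq] at hq
      rw [hKcomp.isClosed.frontier_eq]
      exact ⟨mem_image_of_mem _ hq.1, fun hqi ↦ hq.2 (hint q (hsub hq.1) hqi)⟩
  -- The exit argument runs on `N` itself, so no uniqueness of solutions is needed.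
  · intro γ T hγ0 hγ t ht
    have hcurve : ∀ s ∈ Icc 0 t, IsMIntegralCurveOn γ X (Icc 0 s) := fun s hs ↦
      hγ.mono fun u hu ↦ ⟨hu.1, (hu.2.trans hs.2).trans_lt ht.2⟩
    refine hKU (interior_subset (mem_interior_of_le_initial hKcomp.isClosed hm ht.1
      (fun s hs ↦ ((hcurve t ⟨ht.1, le_rfl⟩) s hs).continuousWithinAt) (hγ0 ▸ hy.1) (hγ0 ▸ hy.2)
      fun s hs _ ↦ le_of_isMIntegralCurveOn hh hXh hs.1 (hcurve s hs)))

end Lyapunov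

/-! ### Immersions -/

section Immersion

variable {E : Type*} [NormedAddCommGroup E] [NormedSpace ℝ E]
  {M : Type*} [TopologicalSpace M] [ChartedSpace E M] [IsManifold 𝓘(ℝ, E) ∞ M]
  {E' : Type*} [NormedAddCommGroup E'] [NormedSpace ℝ E']
  {N : Type*} [TopologicalSpace N] [ChartedSpace E' N] [IsManifold 𝓘(ℝ, E') ∞ N]

/-- The differential of an immersion is injective. -/
theorem injective_mfderiv_of_isImmersionAt {f : N → M} {x : N}
    (hf : Manifold.IsImmersionAt 𝓘(ℝ, E') 𝓘(ℝ, E) ∞ f x) :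
    Function.Injective (mfderiv 𝓘(ℝ, E') 𝓘(ℝ, E) f x) := by
  have : IsManifold 𝓘(ℝ, E) 1 M := IsManifold.of_le (n := ∞) (by simp)
  have : IsManifold 𝓘(ℝ, E') 1 N := IsManifold.of_le (n := ∞) (by simp)
  have hdom := IsManifold.maximalAtlas_subset_of_le (by simp : (1 : WithTop ℕ∞) ≤ ∞)
    hf.domChart_mem_maximalAtlas
  have hcod := IsManifold.maximalAtlas_subset_of_le (by simp : (1 : WithTop ℕ∞) ≤ ∞)
    hf.codChart_mem_maximalAtlas
  have hφ : hf.domChart.MDifferentiable 𝓘(ℝ, E') 𝓘(ℝ, E') :=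
    ⟨fun y hy ↦ (mdifferentiableAt_of_mem_maximalAtlas hdom hy).mdifferentiableWithinAt,
      fun y hy ↦ (mdifferentiableAt_symm_of_mem_maximalAtlas hdom hy).mdifferentiableWithinAt⟩
  let L : E' →L[ℝ] E := hf.equiv.toContinuousLinearMap ∘L ContinuousLinearMap.inl ℝ E' _
  have hL : Function.Injective L := fun a b hab ↦ by
    simpa [L] using hab
  have heq : hf.codChart ∘ f =ᶠ[𝓝 x] L ∘ hf.domChart := by
    filter_upwards [hf.domChart.open_source.mem_nhds hf.mem_domChart_source] with y hy
    have hmem : hf.domChart y ∈ (hf.domChart.extend 𝓘(ℝ, E')).target := by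
      simpa using hf.domChart.map_source hy
    have h := hf.writtenInCharts hmem
    simpa [hf.domChart.left_inv hy, L] using h
  have h1 := ((mdifferentiableAt_of_mem_maximalAtlas hcod hf.mem_codChart_source).hasMFDerivAt.comp
    x (hf.contMDiffAt.mdifferentiableAt (by simp)).hasMFDerivAt)
  have h2 := L.hasMFDerivAt.comp x (hφ.mdifferentiableAt hf.mem_domChart_source).hasMFDerivAt
  -- The differential of `f` followed by that of the target chart is `L` after that of the source
  -- chart, which is injective.
  have h3 := hasMFDerivAt_unique h1 (h2.congr_of_eventuallyEq heq)
  intro v w hvw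
  apply hφ.mfderiv_injective hf.mem_domChart_source
  apply hL
  exact (DFunLike.congr_fun h3 v).symm.trans ((congrArg
    (mfderiv 𝓘(ℝ, E) 𝓘(ℝ, E) hf.codChart (f x)) hvw).trans (DFunLike.congr_fun h3 w))

end Immersion

/-! ### Constrained minima with Lagrange multipliers -/

section ConstrainedMinimum

variable {E : Type*} [NormedAddCommGroup E] [NormedSpace ℝ E] [FiniteDimensional ℝ E]
  {M : Type*} [TopologicalSpace M] [ChartedSpace E M] [IsManifold 𝓘(ℝ, E) ∞ M]
  {κ : Type*} [Fintype κ]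

/-- At a point where `grad G = ∑ σ_a grad f_a`, the combination of Hessians
`Hess G - ∑ σ_a Hess f_a` is the same combination of second derivatives in coordinates. -/
theorem hess_sub_sum_eq (g : SmoothMetric E M) {G : M → ℝ} (hG : ContMDiff 𝓘(ℝ, E) 𝓘(ℝ, ℝ) 2 G)
    {f : κ → M → ℝ} (hf : ∀ a, ContMDiff 𝓘(ℝ, E) 𝓘(ℝ, ℝ) 2 (f a)) (σ : κ → ℝ) {x : M}
    (hgrad : grad g G x = ∑ a, σ a • grad g (f a) x) (v w : TangentSpace 𝓘(ℝ, E) x) :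
    hess g G x v w - ∑ a, σ a * hess g (f a) x v w =
      (fderiv ℝ (fderiv ℝ (G ∘ (extChartAt 𝓘(ℝ, E) x).symm)) (extChartAt 𝓘(ℝ, E) x x)
        - ∑ a, σ a • fderiv ℝ (fderiv ℝ (f a ∘ (extChartAt 𝓘(ℝ, E) x).symm))
          (extChartAt 𝓘(ℝ, E) x x)) (chartDeriv x x v) (chartDeriv x x w) := by
  simp only [hess_eq_fderiv_fderiv g hG, hess_eq_fderiv_fderiv g (hf _), hgrad, mul_add, mul_sub,
    Finset.sum_add_distrib, Finset.sum_sub_distrib, map_sum, map_smul, christoffelFirst_apply,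
    sum_apply, sub_apply, smul_apply, smul_eq_mul]
  simp only [Finset.mul_sum]
  ring_nf

/-- Lowering the index is linear, so it turns the relation between gradients into one between
differentials. -/
theorem fderiv_sub_sum_eq_zero (g : SmoothMetric E M) {G : M → ℝ}
    (hG : ContMDiff 𝓘(ℝ, E) 𝓘(ℝ, ℝ) 2 G) {f : κ → M → ℝ}
    (hf : ∀ a, ContMDiff 𝓘(ℝ, E) 𝓘(ℝ, ℝ) 2 (f a)) (σ : κ → ℝ) {x : M}
    (hgrad : grad g G x = ∑ a, σ a • grad g (f a) x) :
    fderiv ℝ (G ∘ (extChartAt 𝓘(ℝ, E) x).symm) (extChartAt 𝓘(ℝ, E) x x)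
      - ∑ a, σ a • fderiv ℝ (f a ∘ (extChartAt 𝓘(ℝ, E) x).symm) (extChartAt 𝓘(ℝ, E) x x) = 0 := by
  have hp := mem_extChartAt_target (I := 𝓘(ℝ, E)) x
  rw [← coordMetric_coordField_grad g hp (hG.mdifferentiableAt two_ne_zero)]
  simp only [← coordMetric_coordField_grad g hp ((hf _).mdifferentiableAt two_ne_zero),
    coordField_extChartAt_self, hgrad, map_sum, map_smul, sub_self]

variable {E' : Type*} [NormedAddCommGroup E'] [NormedSpace ℝ E'] [FiniteDimensional ℝ E']
  {N : Type*} [TopologicalSpace N] [ChartedSpace E' N] [IsManifold 𝓘(ℝ, E') ∞ N]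

/-- The second-order sufficient condition for a strict constrained local minimum, with Lagrange
multipliers `σ`. -/
theorem eventually_lt_of_hess_pos (g : SmoothMetric E M) {i : N → M}
    (hi : ContMDiff 𝓘(ℝ, E') 𝓘(ℝ, E) ∞ i) {y₀ : N}
    (hinj : Function.Injective (mfderiv 𝓘(ℝ, E') 𝓘(ℝ, E) i y₀))
    {G : M → ℝ} (hG : ContMDiff 𝓘(ℝ, E) 𝓘(ℝ, ℝ) 2 G)
    {f : κ → M → ℝ} (hf : ∀ a, ContMDiff 𝓘(ℝ, E) 𝓘(ℝ, ℝ) 2 (f a))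
    (hconst : ∀ a y, f a (i y) = f a (i y₀)) (σ : κ → ℝ)
    (hgrad : grad g G (i y₀) = ∑ a, σ a • grad g (f a) (i y₀))
    (hpos : ∀ v ∈ (mfderiv 𝓘(ℝ, E') 𝓘(ℝ, E) i y₀).range, v ≠ 0 →
      0 < hess g G (i y₀) v v - ∑ a, σ a * hess g (f a) (i y₀) v v) :
    ∀ᶠ y in 𝓝 y₀, y ≠ y₀ → G (i y₀) < G (i y) := by
  set e := extChartAt 𝓘(ℝ, E) (i y₀) with he
  set ψ := extChartAt 𝓘(ℝ, E') y₀ with hψ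
  have hopen : IsOpen e.target := isOpen_extChartAt_target (i y₀)
  have hp₀ : e (i y₀) ∈ e.target := mem_extChartAt_target (i y₀)
  let j : E' → E := e ∘ i ∘ ψ.symm
  have hj₀ : j (ψ y₀) = e (i y₀) := congrArg (e ∘ i) (extChartAt_to_inv (I := 𝓘(ℝ, E')) y₀)
  have hj : ContDiffAt ℝ 2 j (ψ y₀) := by
    have := (contMDiffAt_iff.1 (hi.contMDiffAt (x := y₀))).2
    simp only [modelWithCornersSelf_coe, range_id] at this
    exact this.of_le ENat.LEInfty.out
  have hjd : ∀ᶠ q in 𝓝 (ψ y₀), DifferentiableAt ℝ j q := by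
    filter_upwards [hj.eventually (by simp)] with q hq using hq.differentiableAt two_ne_zero
  have hjt : ∀ᶠ q in 𝓝 (ψ y₀), j q ∈ e.target :=
    hj.continuousAt.eventually_mem (hopen.mem_nhds (hj₀ ▸ hp₀))
  -- The Lagrangian in coordinates, to be composed with `j`, the map `i` read in charts.
  let φ : E → ℝ := fun p ↦ (G ∘ e.symm) p - ∑ a, σ a * (f a ∘ e.symm) p
  let φ' : E → E →L[ℝ] ℝ := fun p ↦ fderiv ℝ (G ∘ e.symm) p - ∑ a, σ a • fderiv ℝ (f a ∘ e.symm) p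
  have hd : ∀ {u : M → ℝ}, ContMDiff 𝓘(ℝ, E) 𝓘(ℝ, ℝ) 2 u → ∀ p ∈ e.target,
      HasFDerivAt (u ∘ e.symm) (fderiv ℝ (u ∘ e.symm) p) p := fun hu p hp ↦
    (((contDiffOn_comp_extChartAt_symm hu (i y₀)).contDiffAt
      (hopen.mem_nhds hp)).differentiableAt two_ne_zero).hasFDerivAt
  have hφ : ∀ p ∈ e.target, HasFDerivAt φ (φ' p) p := fun p hp ↦
    (hd hG p hp).sub (HasFDerivAt.fun_sum fun a _ ↦ (hd (hf a) p hp).const_mul (σ a))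
  have hφ₀ : φ' (e (i y₀)) = 0 := fderiv_sub_sum_eq_zero g hG hf σ hgrad
  let B : E →L[ℝ] E →L[ℝ] ℝ := fderiv ℝ (fderiv ℝ (G ∘ e.symm)) (e (i y₀))
    - ∑ a, σ a • fderiv ℝ (fderiv ℝ (f a ∘ e.symm)) (e (i y₀))
  have hB : HasFDerivAt φ' B (e (i y₀)) :=
    (differentiableAt_fderiv_comp_extChartAt_symm hG hp₀).hasFDerivAt.sub
      (HasFDerivAt.fun_sum fun a _ ↦
        (differentiableAt_fderiv_comp_extChartAt_symm (hf a) hp₀).hasFDerivAt.const_smul (σ a))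
  have hH : ∀ᶠ q in 𝓝 (ψ y₀), HasFDerivAt (φ ∘ j) ((φ' (j q)).comp (fderiv ℝ j q)) q := by
    filter_upwards [hjd, hjt] with q hq hqt
    exact (hφ _ hqt).comp q hq.hasFDerivAt
  have hjd₀ := hjd.self_of_nhds.hasFDerivAt
  have hH' := (show HasFDerivAt (φ' ∘ j) (B.comp (fderiv ℝ j (ψ y₀))) (ψ y₀) from
    (hj₀ ▸ hB).comp (ψ y₀) hjd₀).clm_comp
      ((hj.fderiv_right (m := 1) (by rw [one_add_one_eq_two])).differentiableAt
        one_ne_zero).hasFDerivAt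
  -- The term with the second derivative of `j` is multiplied by `φ'` at the critical point, hence
  -- drops out.
  have hA : ∀ w : E', ((ContinuousLinearMap.compL ℝ E' E ℝ) ((φ' ∘ j) (ψ y₀)) ∘L
      fderiv ℝ (fderiv ℝ j) (ψ y₀) + (ContinuousLinearMap.compL ℝ E' E ℝ).flip
        (fderiv ℝ j (ψ y₀)) ∘L B ∘L fderiv ℝ j (ψ y₀)) w w =
      B (fderiv ℝ j (ψ y₀) w) (fderiv ℝ j (ψ y₀) w) := fun w ↦ by
    simp [hj₀, hφ₀]
  have : IsManifold 𝓘(ℝ, E) 1 M := IsManifold.of_le (n := ∞) (by simp)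
  have : IsManifold 𝓘(ℝ, E') 1 N := IsManifold.of_le (n := ∞) (by simp)
  have hder : ∀ u : TangentSpace 𝓘(ℝ, E') y₀, fderiv ℝ j (ψ y₀) (chartDeriv y₀ y₀ u) =
      chartDeriv (i y₀) (i y₀) (mfderiv 𝓘(ℝ, E') 𝓘(ℝ, E) i y₀ u) := by
    have h1 := hjd₀.hasMFDerivAt.comp y₀
      (mdifferentiableAt_extChartAt (I := 𝓘(ℝ, E')) (mem_chart_source E' y₀)).hasMFDerivAt
    have h2 := (mdifferentiableAt_extChartAt (I := 𝓘(ℝ, E))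
      (mem_chart_source E (i y₀))).hasMFDerivAt.comp y₀
        (hi.mdifferentiableAt (by simp) (x := y₀)).hasMFDerivAt
    have heq : e ∘ i =ᶠ[𝓝 y₀] j ∘ ψ := by
      filter_upwards [(isOpen_extChartAt_source (I := 𝓘(ℝ, E')) y₀).mem_nhds
        (mem_extChartAt_source y₀)] with y hy
      exact congrArg (e ∘ i) (ψ.left_inv hy).symm
    exact fun u ↦ DFunLike.congr_fun (hasMFDerivAt_unique (h1.congr_of_eventuallyEq heq) h2) u
  have hApos := eventually_lt_of_hasFDerivAt_pos hH (by rw [hj₀, hφ₀, ContinuousLinearMap.zero_comp])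
    hH' (fun u' hu' ↦ by
      obtain ⟨u, rfl⟩ := (isInvertible_mfderiv_extChartAt (I := 𝓘(ℝ, E'))
        (mem_extChartAt_source y₀)).bijective.surjective u'
      have hu : u ≠ 0 := by
        rintro rfl
        exact hu' (map_zero _)
      have h := hpos _ ⟨u, rfl⟩ (fun h ↦ hu (hinj (h.trans (map_zero _).symm)))
      rw [hess_sub_sum_eq g hG hf σ hgrad] at h
      have hB' : 0 < B (fderiv ℝ j (ψ y₀) (chartDeriv y₀ y₀ u))
          (fderiv ℝ j (ψ y₀) (chartDeriv y₀ y₀ u)) := by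
        rw [hder u]
        exact h
      exact hB'.trans_eq (hA _).symm)
  have hψc : ContinuousAt ψ y₀ := continuousAt_extChartAt y₀
  filter_upwards [hψc.eventually hApos, (isOpen_extChartAt_source (I := 𝓘(ℝ, E')) y₀).mem_nhds
    (mem_extChartAt_source y₀), hi.continuous.continuousAt.preimage_mem_nhds
    ((isOpen_extChartAt_source (I := 𝓘(ℝ, E)) (i y₀)).mem_nhds (mem_extChartAt_source (i y₀)))]
    with y hy hysrc hiy hne
  -- Each `f a` is constant along `i`, so `φ ∘ j` is `G ∘ i` up to a constant.
  have hval : ∀ z ∈ ψ.source, i z ∈ e.source →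
      (φ ∘ j) (ψ z) = G (i z) - ∑ a, σ a * f a (i y₀) := fun z hz hiz ↦ by
    simp only [Function.comp, φ, j, ψ.left_inv hz, e.left_inv hiz, hconst _ z]
  have h := hy fun h ↦ hne (ψ.injOn hysrc (mem_extChartAt_source y₀) h)
  rw [hval y hysrc hiy, hval y₀ (mem_extChartAt_source y₀) (mem_extChartAt_source (i y₀))] at h
  linarith

end ConstrainedMinimum

end ConstrainedStability

/-! ### Label stability -/

theorem theorem5p1
    -- the ambient Riemannian manifold `(M, g)`
    {E : Type*} [NormedAddCommGroup E] [NormedSpace ℝ E] [FiniteDimensional ℝ E]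
    {M : Type*} [TopologicalSpace M] [T2Space M] [ChartedSpace E M] [IsManifold 𝓘(ℝ, E) ∞ M]
    (g : ConstrainedStability.SmoothMetric E M)
    -- the submanifold `S`, the preimage of a regular value `c` of `F : M → ℝ^k`
    {k : ℕ} (F : M → EuclideanSpace ℝ (Fin k)) (c : EuclideanSpace ℝ (Fin k))
    (hF : ContMDiff 𝓘(ℝ, E) 𝓘(ℝ, EuclideanSpace ℝ (Fin k)) ∞ F)
    (hc : ConstrainedStability.IsRegularValue (E := E) F c)
    {E' : Type*} [NormedAddCommGroup E'] [NormedSpace ℝ E'] [FiniteDimensional ℝ E']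
    (S : Set M) (hS : S = F ⁻¹' {c})
    [ChartedSpace E' S] [IsManifold 𝓘(ℝ, E') ∞ S]
    (hSM : Manifold.IsSmoothEmbedding 𝓘(ℝ, E') 𝓘(ℝ, E) ∞ (Subtype.val : S → M))
    -- the vector field `X_S` on `S` with the equilibrium `x_e`, and its extension `X` to `M`
    (X_S : (x : S) → TangentSpace 𝓘(ℝ, E') x)
    (hX_S : ConstrainedStability.IsSmoothVectorField X_S)
    (x_e : S) (hx_e : X_S x_e = 0)
    (X : (x : M) → TangentSpace 𝓘(ℝ, E) x)
    (hX : ConstrainedStability.IsSmoothVectorField X)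
    (hXX_S : ∀ x : S, X x = mfderiv 𝓘(ℝ, E') 𝓘(ℝ, E) (Subtype.val : S → M) x (X_S x))
    -- the function `G_S` on `S` and its `C²` extension `G` to `M`
    (G_S : S → ℝ) (G : M → ℝ) (hG : ContMDiff 𝓘(ℝ, E) 𝓘(ℝ, ℝ) 2 G)
    (hGG_S : ∀ x : S, G x = G_S x)
    -- (i)
    (h₁ : ∀ x : M, mvfderiv 𝓘(ℝ, E) G x (X x) ≤ 0)
    -- (ii)
    (h₂ : ConstrainedStability.grad g G x_e =
      ∑ i : Fin k, ConstrainedStability.multiplier g (fun j y ↦ F y j) G i x_e •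
        ConstrainedStability.grad g (fun y ↦ F y i) x_e)
    -- (iii)
    (h₃ : ∀ v ∈ ConstrainedStability.tangentSubspace (E := E) (E' := E') x_e, v ≠ 0 →
      0 < ConstrainedStability.hess g G x_e v v -
        ∑ i : Fin k, ConstrainedStability.multiplier g (fun j y ↦ F y j) G i x_e *
          ConstrainedStability.hess g (fun y ↦ F y i) x_e v v) :
    ConstrainedStability.IsStableEquilibrium X_S x_e := by
  have hi := hSM.contMDiff
  have hid : MDifferentiable 𝓘(ℝ, E') 𝓘(ℝ, E) (Subtype.val : S → M) :=
    hi.mdifferentiable (by simp)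
  have hGd : MDifferentiable 𝓘(ℝ, E) 𝓘(ℝ, ℝ) G := hG.mdifferentiable two_ne_zero
  have hFS : ∀ y : S, F y = c := fun y ↦ by
    have : (y : M) ∈ F ⁻¹' {c} := hS ▸ y.2
    exact this
  refine ConstrainedStability.isStableEquilibrium_of_strict_local_min hX_S hx_e
    (h := G ∘ Subtype.val) (hGd.comp hid) (fun x ↦ ?_)
    (ConstrainedStability.eventually_lt_of_hess_pos g hi
      (ConstrainedStability.injective_mfderiv_of_isImmersionAt (hSM.isImmersion.isImmersionAt x_e))
      hG (fun a ↦ ?_) (fun a y ↦ ?_) _ h₂ h₃)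
  -- As `X` extends `X_S`, the derivative of the restricted `G` along `X_S` is that of `G` along
  -- `X`.
  · rw [mvfderiv_comp_apply x (hGd x) (hid x), ← hXX_S]
    exact h₁ x
  · have := (EuclideanSpace.proj (𝕜 := ℝ) a).contMDiff.comp (hF.of_le (m := 2) ENat.LEInfty.out)
    exact this
  · simp only [hFS]
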